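/- **Proposition 3.2.** Let $(M,\theta,g)$ be a Sasakian sub-Riemannian 3-manifold, that is: $M$ is a smooth 3-manifold with contact form $\theta$, Reeb field $T$ (so $\theta(T)=1$, $d\theta(T,\cdot)=0$), an endomorphism field $J$ with $JT=0$ that is a complex structure on $\mathcal H=\ker\theta$, and a Riemannian metric $g_\theta$ such that $g_\theta(U,V)=\tfrac12 d\theta(U,JV)$ on $\mathcal H$ and $T$ is a unit vector orthogonal to $\mathcal H$; here $d\theta(U,V)=U(\theta(V))-V(\theta(U))-\theta([U,V])$. Let $\nabla$ be its Tanaka connection, the linear connection with $\nabla\theta=0$, $\nabla T=0$, $\nabla g_\theta=0$ and torsion satisfying $T_\nabla(U,V)=d\theta(U,V)T$ for $U,V\in\mathcal H$ and $T_\nabla(T,JU)=-J\,T_\nabla(T,U)$ for all $U$; Sasakian means that $\nabla J=0$ and $T_\nabla(T,\cdot)=0$. For an immersed curve $\gamma$ with arc-length parameter $s$ (with respect to $g_\theta$) and unit tangent $\dot\gamma=\partial\gamma/\partial s$, let $k=g_\theta(\nabla_{\dot\gamma}\dot\gamma,J\dot\gamma)$ be its curvature and $\tau=g_\theta(\dot\gamma,T)$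 its contact normality; $\gamma$ is Legendrian if $\tau\equiv0$. Let $S\subseteq\mathbb R$ be a nondegenerate interval, $a\in S$, $T_0\in(0,\infty]$, and let $\gamma:S\times[0,T_0)\to M$ be a smooth family of immersed curves $\gamma_t=\gamma(\cdot,t)$ with nowhere vanishing curvature which solves $$\frac{\partial\gamma}{\partial t}=-k^{-1}J\dot\gamma-2\Big(\int_0^s k^{-1}\,ds\Big)T,\qquad \gamma(\cdot,0)=\gamma_0,$$ where $s$ is measured on each $\gamma_t$ from the point with parameter $a$. (Curves parametrized by a circle $\mathbb R/L\mathbb Z$ are included: as $L$-periodic maps with $S=\mathbb R$, or as maps on one period $S=[0,L)$.) If the initial curve $\gamma_0$ is Legendrian, then $\gamma_t$ is Legendrian for every $t\in[0,T_0)$. In particular $\partial_t\tau=-\tau$ on $S\times[0,T_0)$, both sides being zero. -/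

import Mathlib

open scoped Manifold ContDiff Topology Bundle

noncomputable section

namespace LegendrianFlow

/-- The model space of a 3-manifold. -/
abbrev E3 : Type := EuclideanSpace ℝ (Fin 3)

section Manifold

variable {M : Type*} [TopologicalSpace M] [ChartedSpace E3 M]

/-- The tangent space of the 3-manifold `M` at `x`. -/
abbrev Tan (x : M) : Type := TangentSpace (𝓡 3) x

variable [IsManifold (𝓡 3) ∞ M]

/-- The vector field `V` is differentiable at `x`. -/
def DiffFieldAt (V : ∀ x : M, Tan x) (x : M) : Prop :=
  MDifferentiableAt (𝓡 3) ((𝓡 3).prod 𝓘(ℝ, E3))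
    (fun y => Bundle.TotalSpace.mk' E3 (E := fun y : M => Tan y) y (V y)) x

/-- The expression `U(θ(V)) - V(θ(U)) - θ([U, V])` at the point `x`, for vector fields `U`, `V`. -/
def dFields (θ : ∀ x : M, Tan x →L[ℝ] ℝ) (U V : ∀ x : M, Tan x) (x : M) : ℝ :=
  mvfderiv (𝓡 3) (fun y => θ y (V y)) x (U x) - mvfderiv (𝓡 3) (fun y => θ y (U y)) x (V x)
    - θ x (VectorField.mlieBracket (𝓡 3) U V x)

/-- The exterior derivative `dθ` at `x` on two tangent vectors `v`, `w`:
`U(θ(V)) - V(θ(U)) - θ([U, V])` at `x`, where `U`, `V` are the extensions of `v`, `w` with constant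
coefficients in the chart at `x`.  By `extDeriv₁_apply` below any other extensions of `v`, `w` to
differentiable vector fields give the same value. -/
def extDeriv₁ (θ : ∀ x : M, Tan x →L[ℝ] ℝ) (x : M) (v w : Tan x) : ℝ :=
  dFields θ (FiberBundle.extend E3 v) (FiberBundle.extend E3 w) x

section Tensoriality

variable {θ : ∀ x : M, Tan x →L[ℝ] ℝ} {x : M}

/-- Differentiability at `x` of a 1-form `θ`. -/
def DiffFormAt (θ : ∀ x : M, Tan x →L[ℝ] ℝ) (x : M) : Prop :=
  MDifferentiableAt (𝓡 3) ((𝓡 3).prod 𝓘(ℝ, E3 →L[ℝ] ℝ))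
    (fun x => Bundle.TotalSpace.mk' (E3 →L[ℝ] ℝ) (E := fun x : M => Tan x →L[ℝ] ℝ) x (θ x)) x

theorem DiffFormAt.apply (hθ : DiffFormAt θ x) {V : ∀ x : M, Tan x} (hV : DiffFieldAt V x) :
    MDifferentiableAt (𝓡 3) 𝓘(ℝ, ℝ) (fun y => θ y (V y)) x := by
  have h : MDifferentiableAt (𝓡 3) ((𝓡 3).prod 𝓘(ℝ, ℝ))
      (fun y => Bundle.TotalSpace.mk' ℝ (E := Bundle.Trivial M ℝ) y (θ y (V y))) x := by
    apply MDifferentiableAt.clm_bundle_apply (F₁ := E3) (E₁ := fun x : M => Tan x)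
      (F₂ := ℝ) (E₂ := Bundle.Trivial M ℝ) (ϕ := θ)
    · exact hθ
    · exact hV
  rw [mdifferentiableAt_totalSpace] at h
  exact h.2

theorem tensorial_dFields_left (hθ : DiffFormAt θ x) (V : ∀ x : M, Tan x) :
    TensorialAt (𝓡 3) E3 (fun U : ∀ x : M, Tan x => dFields θ U V x) x where
  smul {f U} hf hU := by
    have h1 := mvfderiv_fun_mul hf (hθ.apply hU)
    simp [dFields, VectorField.mlieBracket_smul_left hf hU, h1]
    ring
  add {U U'} hU hU' := by
    have h1 := mvfderiv_fun_add (hθ.apply hU) (hθ.apply hU')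
    simp [dFields, VectorField.mlieBracket_add_left hU hU', h1]
    ring

theorem tensorial_dFields_right (hθ : DiffFormAt θ x) (U : ∀ x : M, Tan x) :
    TensorialAt (𝓡 3) E3 (fun V : ∀ x : M, Tan x => dFields θ U V x) x where
  smul {f V} hf hV := by
    have h1 := mvfderiv_fun_mul hf (hθ.apply hV)
    simp [dFields, VectorField.mlieBracket_smul_right hf hV, h1]
    ring
  add {V V'} hV hV' := by
    have h1 := mvfderiv_fun_add (hθ.apply hV) (hθ.apply hV')
    simp [dFields, VectorField.mlieBracket_add_right hV hV', h1]
    ring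

/-- `dθ(U, V) = U(θ(V)) - V(θ(U)) - θ([U, V])` for all vector fields `U`, `V` that are
differentiable at `x`. -/
theorem extDeriv₁_apply (hθ : DiffFormAt θ x) {U V : ∀ x : M, Tan x} (hU : DiffFieldAt U x)
    (hV : DiffFieldAt V x) : extDeriv₁ θ x (U x) (V x) = dFields θ U V x :=
  TensorialAt.mkHom₂_apply (Φ := fun U V : ∀ x : M, Tan x => dFields θ U V x)
    (fun V _ => tensorial_dFields_left hθ V) (fun U _ => tensorial_dFields_right hθ U)
    hU hV

end Tensoriality

end Manifold

section Structure

variable (M : Type*) [TopologicalSpace M] [ChartedSpace E3 M] [IsManifold (𝓡 3) ∞ M]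

/-- A contact sub-Riemannian structure on a 3-manifold `M`, together with its Reeb vector field
`T`, its complex structure `J` (extended by `J T = 0`) and the canonical extension `g_θ` of the
sub-Riemannian metric on the contact distribution `ker θ` to a Riemannian metric on `M`. -/
structure ContactSubRiemannian where
  /-- the contact form -/
  θ : ∀ x : M, Tan x →L[ℝ] ℝ
  /-- the Reeb vector field -/
  T : ∀ x : M, Tan x
  /-- the complex structure of the contact distribution, extended to the tangent bundle -/
  J : ∀ x : M, Tan x →L[ℝ] Tan x
  /-- the Riemannian metric `g_θ` -/
  g : Bundle.ContMDiffRiemannianMetric (𝓡 3) ∞ E3 (fun x : M => Tan x)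
  contMDiff_θ : ContMDiff (𝓡 3) ((𝓡 3).prod 𝓘(ℝ, E3 →L[ℝ] ℝ)) ∞
    (fun x => Bundle.TotalSpace.mk' (E3 →L[ℝ] ℝ) (E := fun x : M => Tan x →L[ℝ] ℝ) x (θ x))
  contMDiff_T : ContMDiff (𝓡 3) ((𝓡 3).prod 𝓘(ℝ, E3)) ∞
    (fun x => Bundle.TotalSpace.mk' E3 (E := fun x : M => Tan x) x (T x))
  contMDiff_J : ContMDiff (𝓡 3) ((𝓡 3).prod 𝓘(ℝ, E3 →L[ℝ] E3)) ∞
    (fun x => Bundle.TotalSpace.mk' (E3 →L[ℝ] E3) (E := fun x : M => Tan x →L[ℝ] Tan x) x (J x))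
  /-- `θ` is a contact form: `dθ` is nondegenerate on `ker θ` (equivalently `θ ∧ dθ` vanishes
  nowhere; `θ` itself vanishes nowhere since `θ T = 1`). -/
  contact : ∀ (x : M) (v : Tan x), θ x v = 0 → v ≠ 0 → ∃ w, θ x w = 0 ∧ extDeriv₁ θ x v w ≠ 0
  θ_T : ∀ x, θ x (T x) = 1
  dθ_T : ∀ x v, extDeriv₁ θ x (T x) v = 0
  J_T : ∀ x, J x (T x) = 0
  θ_J : ∀ x v, θ x (J x v) = 0
  J_sq : ∀ x v, θ x v = 0 → J x (J x v) = -v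
  /-- On `ker θ` one has `g(U, V) = ½ dθ(U, J V)`.  In particular `J` is the rotation by the angle
  `π/2` for which `v ∧ J v` is positive for the orientation given by `dθ`. -/
  g_horizontal : ∀ x v w, θ x v = 0 → θ x w = 0 → g.inner x v w = (1 / 2) * extDeriv₁ θ x v (J x w)
  /-- `T` is a unit vector orthogonal to `ker θ`. -/
  g_T_T : ∀ x, g.inner x (T x) (T x) = 1
  g_horizontal_T : ∀ x v, θ x v = 0 → g.inner x v (T x) = 0

end Structure

variable {M : Type*} [TopologicalSpace M] [ChartedSpace E3 M] [IsManifold (𝓡 3) ∞ M]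

variable (M) in
/-- Linear connections on `M`; `D V x u` is `∇_u V` at `x`. -/
abbrev Connection : Type _ := CovariantDerivative (𝓡 3) E3 (fun x : M => Tan x)

/-- `D` is the Tanaka connection of the contact metric manifold `(M, θ, -J, g_θ)`: the (unique)
smooth linear connection `∇` with `∇θ = 0`, `∇T = 0`, `∇g_θ = 0` and the two torsion conditions
below, where the torsion is `∇_U V - ∇_V U - [U, V]`. -/
structure IsTanakaConnection (C : ContactSubRiemannian M) (D : Connection M) : Prop where
  smooth : CovariantDerivative.ContMDiffCovariantDerivative D ∞
  parallel_θ : ∀ (x : M) (u : Tan x) (V : ∀ y : M, Tan y), DiffFieldAt V x →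
    mvfderiv (𝓡 3) (fun y => C.θ y (V y)) x u = C.θ x (D V x u)
  parallel_T : ∀ (x : M) (u : Tan x), D C.T x u = 0
  parallel_g : ∀ (x : M) (u : Tan x) (V W : ∀ y : M, Tan y), DiffFieldAt V x → DiffFieldAt W x →
    mvfderiv (𝓡 3) (fun y => C.g.inner y (V y) (W y)) x u =
      C.g.inner x (D V x u) (W x) + C.g.inner x (V x) (D W x u)
  torsion_horizontal : ∀ (x : M) (u v : Tan x), C.θ x u = 0 → C.θ x v = 0 →
    D.torsion x u v = extDeriv₁ C.θ x u v • C.T x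
  torsion_T_J : ∀ (x : M) (u : Tan x),
    D.torsion x (C.T x) (C.J x u) = -C.J x (D.torsion x (C.T x) u)

/-- The Sasakian condition, for the Tanaka connection `D`: the tensor `𝒬(U, V) = (∇_V J) U` and the
torsion operator `σ(U) = T_∇(T, U)` vanish. -/
structure IsSasakian (C : ContactSubRiemannian M) (D : Connection M) : Prop where
  Q_eq_zero : ∀ (x : M) (v : Tan x) (U : ∀ y : M, Tan y), DiffFieldAt U x →
    D (fun y => C.J y (U y)) x v - C.J x (D U x v) = 0
  σ_eq_zero : ∀ (x : M) (u : Tan x), D.torsion x (C.T x) u = 0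

/-! ### Curves

A curve is a map `c : ℝ → M` considered on an interval `S ⊆ ℝ` only; all derivatives are taken
within `S` (one-sided at an end point of `S` that belongs to `S`).  A curve parametrized by the
circle `ℝ / Lℤ` is an `L`-periodic `c` with `S = ℝ`, or, if one only looks at one period starting
at the base point, a curve with `S = [0, L)`. -/

/-- The velocity `c'(u)`. -/
def velocity (S : Set ℝ) (c : ℝ → M) (u : ℝ) : Tan (c u) :=
  mfderivWithin 𝓘(ℝ, ℝ) (𝓡 3) c S u (1 : ℝ)

/-- The covariant derivative `∇_u V` at the parameter `u` of a vector field `V` along the curve `c`: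
in the frame `(E_i)` of a chart, `∇_u (∑ V^i E_i) = ∑ (V^i)' E_i + ∑ V^i ∇_{c'} E_i`; here the frame
is that of the chart at `c u`, and `FiberBundle.extend` extends the vector `V u` to the field
`∑ V^i(u) E_i` near `c u`. -/
def covDerivAlong (D : Connection M) (S : Set ℝ) (c : ℝ → M) (V : ∀ u : ℝ, Tan (c u)) (u : ℝ) :
    Tan (c u) :=
  let e := trivializationAt E3 (fun x : M => Tan x) (c u)
  e.symm (c u)
      (derivWithin (fun v => (e (Bundle.TotalSpace.mk' E3 (E := fun x : M => Tan x) (c v) (V v))).2)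
        S u)
    + D (FiberBundle.extend E3 (V u)) (c u) (velocity S c u)

variable (C : ContactSubRiemannian M) (D : Connection M)

/-- The speed `|c'(u)|` with respect to `g_θ`. -/
def speed (S : Set ℝ) (c : ℝ → M) (u : ℝ) : ℝ :=
  √(C.g.inner (c u) (velocity S c u) (velocity S c u))

/-- The unit tangent vector `ċ = |c'|⁻¹ c'`, the derivative of `c` by arc length. -/
def unitTangent (S : Set ℝ) (c : ℝ → M) (u : ℝ) : Tan (c u) :=
  (speed C S c u)⁻¹ • velocity S c u

/-- The curvature `k = g_θ(∇_ċ ċ, J ċ)`, where `∇_ċ = |c'|⁻¹ ∇_u`. -/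
def curvature (S : Set ℝ) (c : ℝ → M) (u : ℝ) : ℝ :=
  C.g.inner (c u)
    ((speed C S c u)⁻¹ • covDerivAlong D S c (unitTangent C S c) u)
    (C.J (c u) (unitTangent C S c u))

/-- The contact normality `τ = g_θ(ċ, T)`. -/
def contactNormality (S : Set ℝ) (c : ℝ → M) (u : ℝ) : ℝ :=
  C.g.inner (c u) (unitTangent C S c u) (C.T (c u))

/-- The curve `c` on `S` is Legendrian: `τ = 0` along `c`. -/
def IsLegendrian (S : Set ℝ) (c : ℝ → M) : Prop :=
  ∀ u ∈ S, contactNormality C S c u = 0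

/-- The integral `∫₀ˢ k⁻¹ ds` from the base point `a` of the arc length to the point with parameter
`u`; here `ds = |c'(v)| dv`. -/
def integralInvCurvature (S : Set ℝ) (c : ℝ → M) (a u : ℝ) : ℝ :=
  ∫ v in a..u, (curvature C D S c v)⁻¹ * speed C S c v

/-- The time interval `[0, T₀)`, where `T₀ = ∞` is allowed. -/
def timeInterval (T₀ : EReal) : Set ℝ := {t | 0 ≤ t ∧ (t : EReal) < T₀}

/-- `γ : S × [0, T₀) → M` is a (smooth) solution, with initial curve `γ₀`, of the Legendrian curve
expanding flow `∂γ/∂t = -k⁻¹ J γ̇ - 2 (∫₀ˢ k⁻¹ ds) T`, `γ(·, 0) = γ₀`; the arc length `s` is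
measured from the point with parameter `a`. -/
structure IsExpandingFlow (S : Set ℝ) (a : ℝ) (T₀ : EReal) (γ₀ : ℝ → M) (γ : ℝ → ℝ → M) :
    Prop where
  smooth : ContMDiffOn 𝓘(ℝ, ℝ × ℝ) (𝓡 3) ∞ (fun p : ℝ × ℝ => γ p.1 p.2) (S ×ˢ timeInterval T₀)
  /-- every `γ(·, t)` is an immersed curve -/
  immersed : ∀ t ∈ timeInterval T₀, ∀ u ∈ S, velocity S (fun v => γ v t) u ≠ 0
  /-- `k⁻¹` makes sense -/
  curvature_ne_zero : ∀ t ∈ timeInterval T₀, ∀ u ∈ S, curvature C D S (fun v => γ v t) u ≠ 0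
  evolution : ∀ t ∈ timeInterval T₀, ∀ u ∈ S,
    velocity (timeInterval T₀) (fun r => γ u r) t =
      -(curvature C D S (fun v => γ v t) u)⁻¹ • C.J (γ u t) (unitTangent C S (fun v => γ v t) u)
        - (2 * integralInvCurvature C D S (fun v => γ v t) a u) • C.T (γ u t)
  initial : ∀ u ∈ S, γ u 0 = γ₀ u

end LegendrianFlow

end

/-! Write `X` for the unit tangent, `v = |γ_u|` for the speed and `f = θ(γ_u) = v τ`. Equality of
mixed partial derivatives gives, for any 1-form, `∂_t θ(γ_u) = ∂_u θ(γ_t) + dθ(γ_t, γ_u)`. Since `θ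
∘ J = 0` and `θ(T) = 1`, the flow has `θ(γ_t) = -2 ∫ k⁻¹ ds`, so the first term is `-2 k⁻¹ v`. Since
`dθ(T, ·) = 0` and `dθ(JX, X) = -2 (1 - τ²)`, the second is `2 k⁻¹ v (1 - τ²)`. The nonlocal term in
the flow is exactly what cancels the leading part, leaving `∂_t f = -2 k⁻¹ v τ² = (-2 k⁻¹ τ) f`. For
fixed `u` this is a homogeneous linear equation in `t`, once `k` and `τ` are regarded as given
continuous functions. As `f = 0` at time zero, Grönwall's inequality gives `f = 0`, hence `τ = 0`
because `v > 0`. The equation `∂_t τ = -τ` then reads `0 = 0`.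

The identity for `∂_t f` is `hasDerivAt_form_velocity`, resting on `hasFDerivAt_form_mfderiv` (mixed
partials) and `extDeriv₁_J_self` (contact algebra). Most of the remaining work is regularity:
`contDiffOn_curvature` shows that `k` is smooth in `(u, t)`, which justifies differentiating the
integral and bounding the coefficient. The computation is made at interior parameters; end points of
`S` follow by continuity. -/

noncomputable section

namespace LegendrianFlow

open Bundle VectorField Set Filter

/-! ### Coordinate frames, their brackets, and connections in a chart -/

section Charts

variable {M : Type*} [TopologicalSpace M] [ChartedSpace E3 M] [IsManifold (𝓡 3) ∞ M]

/-- The trivialization of the tangent bundle given by the chart at `x₀`. -/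
abbrev triv (x₀ : M) :
    Trivialization E3 (TotalSpace.proj : TotalSpace E3 (fun x : M => Tan x) → M) :=
  trivializationAt E3 (fun x : M => Tan x) x₀

/-- The trivialization of the tangent bundle at `x₀` is the differential of the chart, so pulling a
frame field back through the inverse chart undoes it. -/
theorem mpullbackWithin_symm_triv (x₀ : M) (w : E3) {z : M} (hz : z ∈ (chartAt E3 x₀).source) :
    mpullbackWithin 𝓘(ℝ, E3) (𝓡 3) (extChartAt (𝓡 3) x₀).symm
      (fun y => (triv x₀).symm y w) (range (𝓡 3)) (extChartAt (𝓡 3) x₀ z) = w := by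
  have hz' : z ∈ (triv x₀).baseSet := by simpa using hz
  have hl : (extChartAt (𝓡 3) x₀).symm (extChartAt (𝓡 3) x₀ z) = z :=
    (extChartAt (𝓡 3) x₀).left_inv (by simpa using hz)
  rw [mpullbackWithin_apply, ← TangentBundle.symmL_trivializationAt hz]
  have h2 : (triv x₀).symm ((extChartAt (𝓡 3) x₀).symm (extChartAt (𝓡 3) x₀ z)) w
      = (((triv x₀).continuousLinearEquivAt ℝ z hz').symm w : E3) := by
    rw [hl, Trivialization.symm_continuousLinearEquivAt_eq,
      Trivialization.symmL_apply (triv x₀) hz' _]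
  refine (congrArg _ h2).trans ?_
  rw [← Trivialization.symm_continuousLinearEquivAt_eq' _ hz']
  erw [ContinuousLinearMap.inverse_equiv]
  exact ((triv x₀).continuousLinearEquivAt ℝ z hz').apply_symm_apply w

/-- Vector fields with constant coefficients in a chart commute. -/
theorem mlieBracket_extend (x : M) (v w : Tan x) :
    mlieBracket (𝓡 3) (FiberBundle.extend E3 v) (FiberBundle.extend E3 w) x = 0 := by
  have key : ∀ v : Tan x, mpullbackWithin 𝓘(ℝ, E3) (𝓡 3) (extChartAt (𝓡 3) x).symm
      (FiberBundle.extend E3 v) (range (𝓡 3)) =ᶠ[𝓝[range (𝓡 3)] (extChartAt (𝓡 3) x x)]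
        fun _ => (triv x ⟨x, v⟩).2 := by
    intro v
    filter_upwards [extChartAt_target_mem_nhdsWithin (I := 𝓡 3) x] with y hy
    have := mpullbackWithin_symm_triv x (triv x ⟨x, v⟩).2 (z := (extChartAt (𝓡 3) x).symm y)
      (by simpa using (extChartAt (𝓡 3) x).map_target hy)
    rwa [(extChartAt (𝓡 3) x).right_inv hy] at this
  rw [← mlieBracketWithin_univ, mlieBracketWithin_apply]
  have h0 : lieBracketWithin ℝ (mpullbackWithin 𝓘(ℝ, E3) (𝓡 3) (extChartAt (𝓡 3) x).symm
      (FiberBundle.extend E3 v) (range (𝓡 3)))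
      (mpullbackWithin 𝓘(ℝ, E3) (𝓡 3) (extChartAt (𝓡 3) x).symm
        (FiberBundle.extend E3 w) (range (𝓡 3))) ((extChartAt (𝓡 3) x).symm ⁻¹' univ ∩ range (𝓡 3))
        (extChartAt (𝓡 3) x x) = 0 := by
    have hx : extChartAt (𝓡 3) x x ∈ (extChartAt (𝓡 3) x).symm ⁻¹' univ ∩ range (𝓡 3) := by simp
    have e : (extChartAt (𝓡 3) x).symm ⁻¹' univ ∩ range (𝓡 3) = range (𝓡 3) := by simp
    rw [e] at hx ⊢
    -- Both pullbacks agree with constant fields near the point, so both derivatives in the bracket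
    -- vanish.
    refine (Filter.EventuallyEq.lieBracketWithin_vectorField_eq_of_mem (key v) (key w) hx).trans ?_
    rw [lieBracketWithin_eq]
    simp
  erw [h0]
  exact map_zero _

theorem extDeriv₁_eq (θ : ∀ x : M, Tan x →L[ℝ] ℝ) (x : M) (v w : Tan x) :
    extDeriv₁ θ x v w =
      mvfderiv (𝓡 3) (fun y => θ y (FiberBundle.extend E3 w y)) x v
        - mvfderiv (𝓡 3) (fun y => θ y (FiberBundle.extend E3 v y)) x w := by
  simp [extDeriv₁, dFields, mlieBracket_extend]

/-- The flat connection of a trivialization. -/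
def flatConnection (x₀ : M) (V : ∀ y : M, Tan y) (y : M) : Tan y →L[ℝ] Tan y :=
  (triv x₀).symmL ℝ y ∘L mvfderiv (𝓡 3) (fun z => (triv x₀ ⟨z, V z⟩).2) y

theorem mdifferentiableAt_snd_triv {x₀ x : M} (hx : x ∈ (triv x₀).baseSet) {V : ∀ y : M, Tan y} :
    DiffFieldAt V x ↔ MDifferentiableAt (𝓡 3) 𝓘(ℝ, E3) (fun z => (triv x₀ ⟨z, V z⟩).2) x := by
  exact (triv x₀).mdifferentiableAt_section_iff (IB := 𝓡 3) V hx

theorem mvfderiv_congr {f g : M → E3} {x : M} (h : f =ᶠ[𝓝 x] g) :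
    mvfderiv (𝓡 3) f x = mvfderiv (𝓡 3) g x :=
  h.mfderiv_eq

theorem isCovariantDerivativeOn_flatConnection (x₀ : M) :
    IsCovariantDerivativeOn E3 (flatConnection x₀) (triv x₀).baseSet where
  add {V W y} hV hW hy := by
    have h1 := (mdifferentiableAt_snd_triv hy).1 hV
    have h2 := (mdifferentiableAt_snd_triv hy).1 hW
    have : (fun z => (triv x₀ ⟨z, (V + W) z⟩).2) =ᶠ[𝓝 y]
        fun z => (triv x₀ ⟨z, V z⟩).2 + (triv x₀ ⟨z, W z⟩).2 := by
      filter_upwards [(triv x₀).open_baseSet.mem_nhds hy] with z hz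
      exact ((triv x₀).linear ℝ hz).map_add _ _
    rw [flatConnection, mvfderiv_congr this, mvfderiv_fun_add h1 h2, ContinuousLinearMap.comp_add]
    rfl
  leibniz {V f y} hV hf hy := by
    have h1 := (mdifferentiableAt_snd_triv hy).1 hV
    have : (fun z => (triv x₀ ⟨z, (f • V) z⟩).2) =ᶠ[𝓝 y]
        fun z => f z • (triv x₀ ⟨z, V z⟩).2 := by
      filter_upwards [(triv x₀).open_baseSet.mem_nhds hy] with z hz
      exact ((triv x₀).linear ℝ hz).map_smul _ _
    rw [flatConnection, mvfderiv_congr this, mvfderiv_fun_smul hf h1, ContinuousLinearMap.comp_add,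
      ContinuousLinearMap.comp_smul]
    congr 1
    ext1 v
    have : (triv x₀).symmL ℝ y (triv x₀ ⟨y, V y⟩).2 = V y := by
      rw [Trivialization.symmL_apply (triv x₀) hy _, Trivialization.symm_apply_apply_mk _ hy]
    simp [this]

/-- A connection is the flat connection of a trivialization plus its value on the section with
constant coefficients. -/
theorem connection_apply_eq (D : Connection M) {x₀ x : M} (hx : x ∈ (triv x₀).baseSet)
    {V : ∀ y : M, Tan y} (hV : DiffFieldAt V x) :
    D V x = flatConnection x₀ V x + D (fun y => (triv x₀).symm y (triv x₀ ⟨x, V x⟩).2) x := by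
  set w := (triv x₀ ⟨x, V x⟩).2 with hw
  set W : ∀ y : M, Tan y := fun y => (triv x₀).symm y w with hWdef
  have hev : (fun z => (triv x₀ ⟨z, W z⟩).2) =ᶠ[𝓝 x] fun _ => w := by
    filter_upwards [(triv x₀).open_baseSet.mem_nhds hx] with z hz
    simp [hWdef, Trivialization.apply_mk_symm _ hz]
  have hW : DiffFieldAt W x := (mdifferentiableAt_snd_triv hx).2
    (mdifferentiableAt_const.congr_of_eventuallyEq hev)
  -- The difference of two connections is a tensor, so it takes the same value on `V` and on `W`,
  -- which agree at `x`; the flat connection kills `W`.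
  have hD := D.isCovariantDerivativeOn (s := (triv x₀).baseSet)
  have h1 := IsCovariantDerivativeOn.difference_apply hD
    (isCovariantDerivativeOn_flatConnection x₀) hx hV
  have h2 := IsCovariantDerivativeOn.difference_apply hD
    (isCovariantDerivativeOn_flatConnection x₀) hx hW
  have h3 : W x = V x := by
    rw [hWdef, hw]; exact Trivialization.symm_apply_apply_mk _ hx _
  have h4 : flatConnection x₀ W x = 0 := by
    rw [flatConnection, mvfderiv_congr hev, mvfderiv_const]; simp
  rw [h3, h1, h4, sub_zero] at h2
  rw [← h2]; abel

end Charts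

/-! ### Covariant differentiation along a curve -/

section AlongCurves

variable {M : Type*} [TopologicalSpace M] [ChartedSpace E3 M]

theorem hasDerivWithinAt_comp_velocity {F : Type*} [NormedAddCommGroup F] [NormedSpace ℝ F]
    {S : Set ℝ} {c : ℝ → M} {u : ℝ} {f : M → F}
    (hc : MDifferentiableWithinAt 𝓘(ℝ, ℝ) (𝓡 3) c S u)
    (hf : MDifferentiableAt (𝓡 3) 𝓘(ℝ, F) f (c u)) :
    HasDerivWithinAt (fun v => f (c v)) (mvfderiv (𝓡 3) f (c u) (velocity S c u)) S u := by
  have h := (hf.hasMFDerivAt.comp_hasMFDerivWithinAt u hc.hasMFDerivWithinAt)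
  have h' : HasFDerivWithinAt (fun v => f (c v))
      ((mvfderiv (𝓡 3) f (c u)).comp (mfderivWithin 𝓘(ℝ, ℝ) (𝓡 3) c S u) : ℝ →L[ℝ] F) S u :=
    hasMFDerivWithinAt_iff_hasFDerivWithinAt.1 h
  exact h'.hasDerivWithinAt

variable [IsManifold (𝓡 3) ∞ M]

/-- The covariant derivative along a curve can be computed in any trivialization. -/
theorem covDerivAlong_eq (D : Connection M) {S : Set ℝ} {c : ℝ → M} {V : ∀ u : ℝ, Tan (c u)}
    {u : ℝ} (hS : UniqueDiffWithinAt ℝ S u)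
    (hc : MDifferentiableWithinAt 𝓘(ℝ, ℝ) (𝓡 3) c S u) {x₀ : M}
    (hx₀ : c u ∈ (triv x₀).baseSet)
    (hV : DifferentiableWithinAt ℝ (fun v => (triv x₀ ⟨c v, V v⟩).2) S u) :
    covDerivAlong D S c V u =
      (triv x₀).symm (c u) (derivWithin (fun v => (triv x₀ ⟨c v, V v⟩).2) S u)
        + D (fun y => (triv x₀).symm y (triv x₀ ⟨c u, V u⟩).2) (c u) (velocity S c u) := by
  set x := c u with hx
  set ξ : ℝ → E3 := fun v => (triv x₀ ⟨c v, V v⟩).2 with hξ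
  have hxx : x ∈ (triv x).baseSet := FiberBundle.mem_baseSet_trivializationAt' x
  set A : M → E3 →L[ℝ] E3 := fun y => ((triv x₀).coordChangeL ℝ (triv x) y : E3 →L[ℝ] E3) with hA
  have hAd : MDifferentiableAt (𝓡 3) 𝓘(ℝ, E3 →L[ℝ] E3) A x :=
    (contMDiffAt_coordChangeL (n := 1) hx₀ hxx).mdifferentiableAt one_ne_zero
  have hev : ∀ᶠ y in 𝓝 x, y ∈ (triv x₀).baseSet ∩ (triv x).baseSet :=
    ((triv x₀).open_baseSet.inter (triv x).open_baseSet).mem_nhds ⟨hx₀, hxx⟩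
  have hAc := hasDerivWithinAt_comp_velocity hc hAd
  set a' := mvfderiv (𝓡 3) A (c u) (velocity S c u) with ha'
  have h1 : HasDerivWithinAt (fun v => A (c v) (ξ v)) (a' (ξ u) + A x (derivWithin ξ S u)) S u :=
    hAc.clm_apply hV.hasDerivWithinAt
  have happ : ∀ v, c v ∈ (triv x₀).baseSet ∩ (triv x).baseSet →
      A (c v) (ξ v) = (triv x ⟨c v, V v⟩).2 := by
    intro v hv
    rw [hA, ContinuousLinearEquiv.coe_coe, Trivialization.coordChangeL_apply _ _ hv, hξ]
    rw [Trivialization.symm_apply_apply_mk _ hv.1]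
  have h2 : derivWithin (fun v => (triv x ⟨c v, V v⟩).2) S u
      = a' (ξ u) + A x (derivWithin ξ S u) := by
    refine (h1.congr_of_eventuallyEq ?_ (happ u ⟨hx₀, hxx⟩).symm).derivWithin hS
    filter_upwards [hc.continuousWithinAt.eventually hev] with v hv using (happ v hv).symm
  set W : ∀ y : M, Tan y := fun y => (triv x₀).symm y (ξ u) with hW
  have hWx : W x = V u := Trivialization.symm_apply_apply_mk _ hx₀ _
  have hWev : (fun z => (triv x ⟨z, W z⟩).2) =ᶠ[𝓝 x] fun z => A z (ξ u) := by
    filter_upwards [hev] with z hz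
    rw [hA, ContinuousLinearEquiv.coe_coe, Trivialization.coordChangeL_apply _ _ hz]
  have hAw : MDifferentiableAt (𝓡 3) 𝓘(ℝ, E3) (fun z => A z (ξ u)) x :=
    hAd.clm_apply mdifferentiableAt_const
  have hWd : DiffFieldAt W x := (mdifferentiableAt_snd_triv hxx).2
    (hAw.congr_of_eventuallyEq hWev)
  have h3 : mvfderiv (𝓡 3) (fun z => A z (ξ u)) x (velocity S c u) = a' (ξ u) := by
    have e1 := hasDerivWithinAt_comp_velocity hc hAw
    have e2 := hAc.clm_apply (hasDerivWithinAt_const u S (ξ u))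
    have := hS.eq_deriv _ e1 e2
    simpa using this
  -- Changing charts differentiates the transition map `A`, producing the extra term `a' (ξ u)`. It
  -- equals the flat part, in the chart at `x`, of the derivative of the `x₀`-frame field `W`, so
  -- the two expressions match.
  have h4 := congrArg (fun L : Tan x →L[ℝ] Tan x => L (velocity S c u))
    (connection_apply_eq D hxx hWd)
  rw [covDerivAlong]
  rw [h2, h4, flatConnection, mvfderiv_congr hWev, hWx]
  simp only [add_apply, ContinuousLinearMap.comp_apply]
  rw [h3, ← Trivialization.symmL_apply (R := ℝ) _ hxx, map_add,
    Trivialization.symmL_apply (R := ℝ) _ hxx (A x _), hA, ContinuousLinearEquiv.coe_coe,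
    Trivialization.coordChangeL_apply _ _ ⟨hx₀, hxx⟩, Trivialization.symm_apply_apply_mk _ hxx]
  have hadd := fun p q r : Tan x => (by abel : p + q + r = q + (p + r))
  exact hadd _ _ _

/-- A bump function makes a coordinate frame field global, so that smoothness of a connection on
global smooth sections can be applied to it. -/
theorem exists_section_eventuallyEq [T2Space M] (x₀ : M) (w : E3) :
    ∃ σ : ∀ y : M, Tan y, ContMDiff (𝓡 3) ((𝓡 3).prod 𝓘(ℝ, E3)) ∞
      (fun y => TotalSpace.mk' E3 (E := fun y : M => Tan y) y (σ y)) ∧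
      ∀ᶠ y in 𝓝 x₀, σ y = (triv x₀).symm y w := by
  let f : SmoothBumpFunction (𝓡 3) x₀ := Classical.arbitrary _
  have hs : ContMDiffOn (𝓡 3) ((𝓡 3).prod 𝓘(ℝ, E3)) ∞
      (fun y => TotalSpace.mk' E3 (E := fun y : M => Tan y) y ((triv x₀).symm y w))
      (triv x₀).baseSet := by
    rw [(triv x₀).contMDiffOn_section_iff (triv x₀).open_baseSet subset_rfl]
    refine contMDiffOn_const (c := w) |>.congr fun y hy => ?_
    rw [Trivialization.apply_mk_symm _ hy]
  refine ⟨fun y => f y • (triv x₀).symm y w, ?_, ?_⟩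
  · refine ContMDiffOn.smul_section_of_tsupport f.contMDiff.contMDiffOn
      (triv x₀).open_baseSet ?_ hs
    simpa using f.tsupport_subset_chartAt_source
  · filter_upwards [f.eventuallyEq_one] with y hy
    simp [hy]

end AlongCurves

/-! ### Smooth dependence on both parameters of a family of curves -/

section Families

variable {M : Type*} [TopologicalSpace M] [ChartedSpace E3 M] [IsManifold (𝓡 3) ∞ M]

/-- Smoothness of a vector field along a family of curves. -/
abbrev SmoothAlong (Q : Set (ℝ × ℝ)) (γ : ℝ → ℝ → M) (V : ∀ p : ℝ × ℝ, Tan (γ p.1 p.2)) : Prop :=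
  ContMDiffOn 𝓘(ℝ, ℝ × ℝ) ((𝓡 3).prod 𝓘(ℝ, E3)) ∞
    (fun p => TotalSpace.mk' E3 (E := fun y : M => Tan y) (γ p.1 p.2) (V p)) Q

/-- The coordinates, in the chart at `x₀`, of a vector field along a family of curves. -/
abbrev coordsAlong (x₀ : M) (γ : ℝ → ℝ → M) (V : ∀ p : ℝ × ℝ, Tan (γ p.1 p.2)) (p : ℝ × ℝ) : E3 :=
  (triv x₀ ⟨γ p.1 p.2, V p⟩).2

variable {S I : Set ℝ} {γ : ℝ → ℝ → M}

theorem smoothAlong_of_coords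
    (hγ : ContMDiffOn 𝓘(ℝ, ℝ × ℝ) (𝓡 3) ∞ (fun p : ℝ × ℝ => γ p.1 p.2) (S ×ˢ I))
    {V : ∀ p : ℝ × ℝ, Tan (γ p.1 p.2)}
    (h : ∀ p ∈ S ×ˢ I, ContDiffWithinAt ℝ ∞ (coordsAlong (γ p.1 p.2) γ V) (S ×ˢ I) p) :
    SmoothAlong (S ×ˢ I) γ V := fun p hp =>
  contMDiffWithinAt_totalSpace.2 ⟨hγ p hp, (h p hp).contMDiffWithinAt⟩

theorem SmoothAlong.coords {V : ∀ p : ℝ × ℝ, Tan (γ p.1 p.2)} {Q : Set (ℝ × ℝ)}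
    (h : SmoothAlong Q γ V) {p : ℝ × ℝ} (hp : p ∈ Q) {x₀ : M}
    (hx₀ : γ p.1 p.2 ∈ (triv x₀).baseSet) : ContDiffWithinAt ℝ ∞ (coordsAlong x₀ γ V) Q p :=
  (((triv x₀).contMDiffWithinAt_iff (by simpa [Trivialization.mem_source] using hx₀)).1
    (h p hp)).2.contDiffWithinAt

theorem SmoothAlong.smul
    (hγ : ContMDiffOn 𝓘(ℝ, ℝ × ℝ) (𝓡 3) ∞ (fun p : ℝ × ℝ => γ p.1 p.2) (S ×ˢ I))
    {V : ∀ p : ℝ × ℝ, Tan (γ p.1 p.2)} (hV : SmoothAlong (S ×ˢ I) γ V) {f : ℝ × ℝ → ℝ}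
    (hf : ContDiffOn ℝ ∞ f (S ×ˢ I)) : SmoothAlong (S ×ˢ I) γ (fun p => f p • V p) := by
  refine smoothAlong_of_coords hγ fun p hp => ?_
  have hb : γ p.1 p.2 ∈ (triv (γ p.1 p.2)).baseSet := FiberBundle.mem_baseSet_trivializationAt' _
  refine ((hf p hp).smul (hV.coords hp hb)).congr_of_eventuallyEq_of_mem ?_ hp
  filter_upwards [(hγ p hp).continuousWithinAt.eventually
    ((triv (γ p.1 p.2)).open_baseSet.mem_nhds hb)] with q hq
  exact ((triv (γ p.1 p.2)).linear ℝ hq).map_smul _ _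

theorem SmoothAlong.inner {C : ContactSubRiemannian M}
    {V W : ∀ p : ℝ × ℝ, Tan (γ p.1 p.2)}
    (hγ : ContMDiffOn 𝓘(ℝ, ℝ × ℝ) (𝓡 3) ∞ (fun p : ℝ × ℝ => γ p.1 p.2) (S ×ˢ I))
    (hV : SmoothAlong (S ×ˢ I) γ V) (hW : SmoothAlong (S ×ˢ I) γ W) :
    ContDiffOn ℝ ∞ (fun p => C.g.inner (γ p.1 p.2) (V p) (W p)) (S ×ˢ I) := by
  have h : ContMDiffOn 𝓘(ℝ, ℝ × ℝ) ((𝓡 3).prod 𝓘(ℝ, ℝ)) ∞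
      (fun p => TotalSpace.mk' ℝ (E := Bundle.Trivial M ℝ) (γ p.1 p.2)
        (C.g.inner (γ p.1 p.2) (V p) (W p))) (S ×ˢ I) := by
    apply ContMDiffOn.clm_bundle_apply₂ (F₁ := E3) (F₂ := E3) (E₁ := fun x : M => Tan x)
      (E₂ := fun x : M => Tan x)
    · exact C.g.contMDiff.comp_contMDiffOn hγ
    · exact hV
    · exact hW
  intro p hp
  exact (contMDiffWithinAt_totalSpace.1 (h p hp)).2.contDiffWithinAt

theorem SmoothAlong.J {C : ContactSubRiemannian M} {V : ∀ p : ℝ × ℝ, Tan (γ p.1 p.2)}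
    (hγ : ContMDiffOn 𝓘(ℝ, ℝ × ℝ) (𝓡 3) ∞ (fun p : ℝ × ℝ => γ p.1 p.2) (S ×ˢ I))
    (hV : SmoothAlong (S ×ˢ I) γ V) :
    SmoothAlong (S ×ˢ I) γ (fun p => C.J (γ p.1 p.2) (V p)) :=
  ContMDiffOn.clm_bundle_apply (F₁ := E3) (F₂ := E3) (E₁ := fun x : M => Tan x)
      (E₂ := fun x : M => Tan x) (C.contMDiff_J.comp_contMDiffOn hγ) hV

theorem velocity_fst_eq (hS : UniqueDiffOn ℝ S) {p : ℝ × ℝ} (hp : p ∈ S ×ˢ I)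
    (hγ : ContMDiffOn 𝓘(ℝ, ℝ × ℝ) (𝓡 3) ∞ (fun p : ℝ × ℝ => γ p.1 p.2) (S ×ˢ I)) :
    velocity S (fun v => γ v p.2) p.1 =
      mfderivWithin 𝓘(ℝ, ℝ × ℝ) (𝓡 3) (fun p : ℝ × ℝ => γ p.1 p.2) (S ×ˢ I) p
        ((1, 0) : ℝ × ℝ) := by
  have h1 := ((hγ p hp).mdifferentiableWithinAt (by simp)).hasMFDerivWithinAt
  have h2 : HasMFDerivWithinAt 𝓘(ℝ, ℝ) 𝓘(ℝ, ℝ × ℝ) (fun v : ℝ => (v, p.2)) S p.1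
      (ContinuousLinearMap.inl ℝ ℝ ℝ) :=
    ((hasFDerivAt_prodMk_left p.1 p.2).hasFDerivWithinAt).hasMFDerivWithinAt
  have hmaps : S ⊆ (fun v : ℝ => (v, p.2)) ⁻¹' (S ×ˢ I) := fun v hv => ⟨hv, hp.2⟩
  have h3 := (HasMFDerivWithinAt.comp p.1 (f := fun v : ℝ => (v, p.2)) h1 h2 hmaps).mfderivWithin
    (hS p.1 hp.1).uniqueMDiffWithinAt
  rw [velocity]
  erw [h3]
  rfl

/-- The velocity is the tangent map of the two-parameter family applied to the constant field `(1,
0)`. -/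
theorem smoothAlong_velocity (hS : UniqueDiffOn ℝ S) (hI : UniqueDiffOn ℝ I)
    (hγ : ContMDiffOn 𝓘(ℝ, ℝ × ℝ) (𝓡 3) ∞ (fun p : ℝ × ℝ => γ p.1 p.2) (S ×ˢ I)) :
    SmoothAlong (S ×ˢ I) γ (fun p => velocity S (fun v => γ v p.2) p.1) := by
  have h1 := hγ.contMDiffOn_tangentMapWithin (m := ∞) (by simp) (hS.prod hI).uniqueMDiffOn
  let X : ∀ p : ℝ × ℝ, TangentSpace 𝓘(ℝ, ℝ × ℝ) p := fun _ => ((1, 0) : ℝ × ℝ)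
  have h2 : ContMDiff 𝓘(ℝ, ℝ × ℝ) 𝓘(ℝ, ℝ × ℝ).tangent ∞
      (fun p : ℝ × ℝ => (⟨p, X p⟩ : TangentBundle 𝓘(ℝ, ℝ × ℝ) (ℝ × ℝ))) := by
    rw [contMDiff_vectorSpace_iff_contDiff]
    exact contDiff_const
  refine (h1.comp h2.contMDiffOn (fun p hp => hp)).congr fun p hp => ?_
  exact congrArg (fun v : Tan (γ p.1 p.2) =>
    TotalSpace.mk' E3 (E := fun y : M => Tan y) (γ p.1 p.2) v) (velocity_fst_eq hS hp hγ)

/-- On fields with constant coefficients the flat connection vanishes, so there `D` is the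
difference tensor, which is linear in the value `w`: these are the Christoffel symbols. -/
theorem connection_const_eq (D : Connection M) {x₀ x : M} (hx : x ∈ (triv x₀).baseSet) (w : E3) :
    D (fun y => (triv x₀).symm y w) x =
      ∑ i, w i • D (fun y => (triv x₀).symm y (EuclideanSpace.basisFun (Fin 3) ℝ i)) x := by
  have hD := D.isCovariantDerivativeOn (s := (triv x₀).baseSet)
  have key : ∀ w : E3, D (fun y => (triv x₀).symm y w) x =
      IsCovariantDerivativeOn.difference hD (isCovariantDerivativeOn_flatConnection x₀) x
        ((triv x₀).symmL ℝ x w) := by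
    intro w
    have hev : (fun z => (triv x₀ ⟨z, (triv x₀).symm z w⟩).2) =ᶠ[𝓝 x] fun _ => w := by
      filter_upwards [(triv x₀).open_baseSet.mem_nhds hx] with z hz
      rw [Trivialization.apply_mk_symm _ hz]
    have hW : DiffFieldAt (fun y => (triv x₀).symm y w) x := (mdifferentiableAt_snd_triv hx).2
      (mdifferentiableAt_const.congr_of_eventuallyEq hev)
    have h := IsCovariantDerivativeOn.difference_apply hD
      (isCovariantDerivativeOn_flatConnection x₀) hx hW
    rw [Trivialization.symmL_apply (triv x₀) hx w, h, flatConnection, mvfderiv_congr hev,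
      mvfderiv_const]
    simp
  have hsum : w = ∑ i, w i • EuclideanSpace.basisFun (Fin 3) ℝ i :=
    ((EuclideanSpace.basisFun (Fin 3) ℝ).sum_repr w).symm
  conv_lhs => rw [key, hsum]
  simp only [map_sum, map_smul, key]

/-- The chart used in `covDerivAlong` moves with the point. Near a given point it may be replaced by
one fixed chart, by `covDerivAlong_eq`; the result is then a derivative of coordinates plus
Christoffel terms, visibly smooth. -/
theorem SmoothAlong.covDerivAlong [T2Space M] {D : Connection M}
    (hD : CovariantDerivative.ContMDiffCovariantDerivative D ∞)
    (hS : UniqueDiffOn ℝ S) (hI : UniqueDiffOn ℝ I)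
    (hγ : ContMDiffOn 𝓘(ℝ, ℝ × ℝ) (𝓡 3) ∞ (fun p : ℝ × ℝ => γ p.1 p.2) (S ×ˢ I))
    {V : ∀ p : ℝ × ℝ, Tan (γ p.1 p.2)} (hV : SmoothAlong (S ×ˢ I) γ V) :
    SmoothAlong (S ×ˢ I) γ
      (fun p => covDerivAlong D S (fun v => γ v p.2) (fun v => V (v, p.2)) p.1) := by
  refine smoothAlong_of_coords hγ fun p₀ hp₀ => ?_
  set x₀ := γ p₀.1 p₀.2 with hx₀
  have hb : x₀ ∈ (triv x₀).baseSet := FiberBundle.mem_baseSet_trivializationAt' _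
  have hQ := hS.prod hI
  have hnear : ∀ {P : M → Prop}, (∀ᶠ y in 𝓝 x₀, P y) →
      ∀ᶠ p : ℝ × ℝ in 𝓝[S ×ˢ I] p₀, P (γ p.1 p.2) := fun h =>
    (hγ p₀ hp₀).continuousWithinAt.eventually h
  choose σ hσ hσeq using fun i =>
    exists_section_eventuallyEq x₀ (EuclideanSpace.basisFun (Fin 3) ℝ i)
  have hvel := smoothAlong_velocity hS hI hγ
  have hDσ : ∀ i, SmoothAlong (S ×ˢ I) γ
      (fun p => D (σ i) (γ p.1 p.2) (velocity S (fun v => γ v p.2) p.1)) := by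
    intro i
    have h1 := hD.contMDiff.contMDiff (σ := σ i) (hσ i).contMDiffOn
    exact ContMDiffOn.clm_bundle_apply (F₁ := E3) (F₂ := E3) (E₁ := fun x : M => Tan x)
      (E₂ := fun x : M => Tan x) (h1.comp hγ (fun _ _ => mem_univ _)) hvel
  have hX := hV.coords hp₀ hb
  have hXi : ∀ i, ContDiffWithinAt ℝ ∞ (fun p => coordsAlong x₀ γ V p i) (S ×ˢ I) p₀ := fun i =>
    (EuclideanSpace.proj (𝕜 := ℝ) i).contDiff.contDiffAt.comp_contDiffWithinAt p₀ hX
  have hmain : ContDiffWithinAt ℝ ∞ (fun p => fderivWithin ℝ (coordsAlong x₀ γ V) (S ×ˢ I) p (1, 0)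
      + ∑ i, coordsAlong x₀ γ V p i • coordsAlong x₀ γ
        (fun p => D (σ i) (γ p.1 p.2) (velocity S (fun v => γ v p.2) p.1)) p) (S ×ˢ I) p₀ :=
    (hX.fderivWithin_right_apply contDiffWithinAt_const hQ (by simp) hp₀).add
      (ContDiffWithinAt.sum fun i _ => (hXi i).smul ((hDσ i).coords hp₀ hb))
  refine hmain.congr_of_eventuallyEq_of_mem ?_ hp₀
  -- A connection depends on the germ of a section, so `σ i` must equal the frame field on a
  -- neighbourhood of each nearby point `y`, not just at `y`.
  have hσ' : ∀ᶠ y in 𝓝 x₀, ∀ i, ∀ᶠ z in 𝓝 y,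
      σ i z = (triv x₀).symm z (EuclideanSpace.basisFun (Fin 3) ℝ i) :=
    eventually_all.2 fun i => eventually_eventually_nhds.2 (hσeq i)
  filter_upwards [hnear ((triv x₀).open_baseSet.mem_nhds hb), hnear hσ', self_mem_nhdsWithin]
    with p hp hpσ hpQ
  have hXp := (hV.coords hpQ hp).differentiableWithinAt (by simp)
  have hline : HasDerivWithinAt (fun v : ℝ => (v, p.2)) ((1, 0) : ℝ × ℝ) S p.1 :=
    (hasDerivWithinAt_id _ _).prodMk (hasDerivWithinAt_const _ _ _)
  have hmaps : MapsTo (fun v : ℝ => (v, p.2)) S (S ×ˢ I) := fun v hv => ⟨hv, hpQ.2⟩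
  have hder : HasDerivWithinAt (fun v => coordsAlong x₀ γ V (v, p.2))
      (fderivWithin ℝ (coordsAlong x₀ γ V) (S ×ˢ I) p (1, 0)) S p.1 :=
    HasFDerivWithinAt.comp_hasDerivWithinAt (f := fun v : ℝ => (v, p.2))
      (l := coordsAlong x₀ γ V) p.1 hXp.hasFDerivWithinAt hline hmaps
  have hc : MDifferentiableWithinAt 𝓘(ℝ, ℝ) (𝓡 3) (fun v => γ v p.2) S p.1 :=
    ((hγ p hpQ).mdifferentiableWithinAt (by simp)).comp p.1
      hline.differentiableWithinAt.mdifferentiableWithinAt hmaps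
  have hconn : ∀ i, D (fun y => (triv x₀).symm y (EuclideanSpace.basisFun (Fin 3) ℝ i))
      (γ p.1 p.2) = D (σ i) (γ p.1 p.2) := by
    intro i
    refine D.isCovariantDerivativeOnUniv.congr_of_eventuallyEq ?_ ?_ univ_mem
      ((hpσ i).mono fun _ h => h.symm)
    · have := ((hσ i).mdifferentiableAt (by simp) : DiffFieldAt (σ i) (γ p.1 p.2))
      refine this.congr_of_eventuallyEq ?_
      filter_upwards [hpσ i] with z hz
      rw [hz]
    · exact (hσ i).mdifferentiableAt (by simp)
  have h := covDerivAlong_eq D (V := fun v => V (v, p.2)) (hS p.1 hpQ.1) hc hp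
    hder.differentiableWithinAt
  simp only [coordsAlong]
  rw [h, hder.derivWithin (hS p.1 hpQ.1), connection_const_eq D hp]
  simp only [hconn]
  have hlin : ∀ v : Tan (γ p.1 p.2), (triv x₀ ⟨γ p.1 p.2, v⟩).2 =
      (triv x₀).continuousLinearMapAt ℝ (γ p.1 p.2) v := fun v =>
    (Trivialization.continuousLinearMapAt_apply_of_mem ℝ (triv x₀) hp v).symm
  rw [hlin, map_add, ← hlin, Trivialization.apply_mk_symm _ hp]
  simp only [FunLike.coe_sum, Finset.sum_apply, FunLike.coe_smul,
    Pi.smul_apply, map_sum, map_smul, hlin]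

/-! ### Smoothness of speed, unit tangent and curvature -/

section Geometry

variable {C : ContactSubRiemannian M} {D : Connection M}

theorem speed_pos {c : ℝ → M} {u : ℝ} (h : velocity S c u ≠ 0) : 0 < speed C S c u :=
  Real.sqrt_pos.2 (C.g.pos _ _ h)

theorem contDiffOn_speed (hS : UniqueDiffOn ℝ S) (hI : UniqueDiffOn ℝ I)
    (hγ : ContMDiffOn 𝓘(ℝ, ℝ × ℝ) (𝓡 3) ∞ (fun p : ℝ × ℝ => γ p.1 p.2) (S ×ˢ I))
    (himm : ∀ p ∈ S ×ˢ I, velocity S (fun v => γ v p.2) p.1 ≠ 0) :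
    ContDiffOn ℝ ∞ (fun p : ℝ × ℝ => speed C S (fun v => γ v p.2) p.1) (S ×ˢ I) := by
  have hvel := smoothAlong_velocity hS hI hγ
  exact (SmoothAlong.inner (C := C) hγ hvel hvel).sqrt fun p hp => (C.g.pos _ _ (himm p hp)).ne'

theorem smoothAlong_unitTangent (hS : UniqueDiffOn ℝ S) (hI : UniqueDiffOn ℝ I)
    (hγ : ContMDiffOn 𝓘(ℝ, ℝ × ℝ) (𝓡 3) ∞ (fun p : ℝ × ℝ => γ p.1 p.2) (S ×ˢ I))
    (himm : ∀ p ∈ S ×ˢ I, velocity S (fun v => γ v p.2) p.1 ≠ 0) :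
    SmoothAlong (S ×ˢ I) γ (fun p => unitTangent C S (fun v => γ v p.2) p.1) :=
  (smoothAlong_velocity hS hI hγ).smul hγ ((contDiffOn_speed hS hI hγ himm).inv fun p hp =>
    (speed_pos (himm p hp)).ne')

theorem contDiffOn_curvature [T2Space M]
    (hD : CovariantDerivative.ContMDiffCovariantDerivative D ∞)
    (hS : UniqueDiffOn ℝ S) (hI : UniqueDiffOn ℝ I)
    (hγ : ContMDiffOn 𝓘(ℝ, ℝ × ℝ) (𝓡 3) ∞ (fun p : ℝ × ℝ => γ p.1 p.2) (S ×ˢ I))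
    (himm : ∀ p ∈ S ×ˢ I, velocity S (fun v => γ v p.2) p.1 ≠ 0) :
    ContDiffOn ℝ ∞ (fun p : ℝ × ℝ => curvature C D S (fun v => γ v p.2) p.1) (S ×ˢ I) := by
  have hT := smoothAlong_unitTangent (C := C) hS hI hγ himm
  have hcov := (SmoothAlong.covDerivAlong hD hS hI hγ hT).smul hγ
    ((contDiffOn_speed (C := C) hS hI hγ himm).inv fun p hp => (speed_pos (himm p hp)).ne')
  exact hcov.inner hγ (hT.J hγ)

end Geometry

end Families

/-! ### Mixed partial derivatives and the exterior derivative -/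

section MixedPartials

variable {M : Type*} [TopologicalSpace M] [ChartedSpace E3 M] [IsManifold (𝓡 3) ∞ M]

/-- A 1-form in the chart at `x₀`. -/
def formInChart (θ : ∀ x : M, Tan x →L[ℝ] ℝ) (x₀ y : M) : E3 →L[ℝ] ℝ :=
  θ y ∘L (triv x₀).symmL ℝ y

theorem mdifferentiableAt_formInChart {θ : ∀ x : M, Tan x →L[ℝ] ℝ} {x : M} (hθ : DiffFormAt θ x) :
    MDifferentiableAt (𝓡 3) 𝓘(ℝ, E3 →L[ℝ] ℝ) (formInChart θ x) x := by
  have h := (mdifferentiableAt_hom_bundle (F₁ := E3) (E₁ := fun x : M => Tan x) (F₂ := ℝ)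
    (E₂ := Bundle.Trivial M ℝ) (IB := 𝓡 3) (IM := 𝓡 3) (f := fun y => ⟨y, θ y⟩) (x₀ := x)).1 hθ
  refine h.2.congr_of_eventuallyEq ?_
  filter_upwards [] with y
  ext w
  simp [formInChart, ContinuousLinearMap.inCoordinates]

/-- This replaces the tangent vectors `∂_a Γ` by derivatives of a vector-valued map, for which
symmetry of the second derivative is available. -/
theorem fderiv_coords_eq {U : Set (ℝ × ℝ)} (hU : IsOpen U) {Γ : ℝ × ℝ → M}
    (hΓ : ContMDiffOn 𝓘(ℝ, ℝ × ℝ) (𝓡 3) ∞ Γ U) {x₀ : M} {q : ℝ × ℝ} (hq : q ∈ U)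
    (hx₀ : Γ q ∈ (triv x₀).baseSet) (a : ℝ × ℝ) :
    fderiv ℝ (extChartAt (𝓡 3) x₀ ∘ Γ) q a =
      (triv x₀ ⟨Γ q, mfderiv 𝓘(ℝ, ℝ × ℝ) (𝓡 3) Γ q a⟩).2 := by
  have hs : Γ q ∈ (chartAt E3 x₀).source := by simpa using hx₀
  have h1 := ((hΓ q hq).contMDiffAt (hU.mem_nhds hq)).mdifferentiableAt (by simp)
  have h2 : MDifferentiableAt (𝓡 3) 𝓘(ℝ, E3) (extChartAt (𝓡 3) x₀) (Γ q) :=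
    mdifferentiableAt_extChartAt hs
  have h3 : fderiv ℝ (extChartAt (𝓡 3) x₀ ∘ Γ) q =
      (mfderiv (𝓡 3) 𝓘(ℝ, E3) (extChartAt (𝓡 3) x₀) (Γ q)).comp
        (mfderiv 𝓘(ℝ, ℝ × ℝ) (𝓡 3) Γ q) := by
    rw [← mfderiv_eq_fderiv]
    exact mfderiv_comp q h2 h1
  rw [h3, ← Trivialization.continuousLinearMapAt_apply_of_mem ℝ (triv x₀) hx₀,
    TangentBundle.continuousLinearMapAt_trivializationAt hs]
  rfl

/-- The extension has constant coordinates, so only the coefficients of `θ` are differentiated. -/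
theorem mvfderiv_form_extend {θ : ∀ x : M, Tan x →L[ℝ] ℝ} {x : M} (hθ : DiffFormAt θ x)
    (v w : Tan x) : mvfderiv (𝓡 3) (fun y => θ y (FiberBundle.extend E3 w y)) x v =
      (mvfderiv (𝓡 3) (formInChart θ x) x v) (triv x ⟨x, w⟩).2 := by
  have hev : (fun y => θ y (FiberBundle.extend E3 w y)) =ᶠ[𝓝 x]
      fun y => formInChart θ x y (triv x ⟨x, w⟩).2 := by
    filter_upwards [(triv x).open_baseSet.mem_nhds
      (FiberBundle.mem_baseSet_trivializationAt' x)] with y hy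
    simp only [formInChart, ContinuousLinearMap.comp_apply]
    rw [Trivialization.symmL_apply (triv x) hy]
    rfl
  have h1 := (ContinuousLinearMap.apply ℝ ℝ (triv x ⟨x, w⟩).2).hasMFDerivAt.comp x
    (mdifferentiableAt_formInChart hθ).hasMFDerivAt
  have h2 := (h1.congr_of_eventuallyEq hev).mfderiv
  rw [mvfderiv]
  erw [h2]
  rfl

/-- Equality of mixed partial derivatives, in the form `dθ(Γ_b, Γ_a) = ∂_b θ(Γ_a) - ∂_a θ(Γ_b)`. -/
theorem hasFDerivAt_form_mfderiv {θ : ∀ x : M, Tan x →L[ℝ] ℝ} {U : Set (ℝ × ℝ)} (hU : IsOpen U)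
    {Γ : ℝ × ℝ → M} (hΓ : ContMDiffOn 𝓘(ℝ, ℝ × ℝ) (𝓡 3) ∞ Γ U) {p : ℝ × ℝ} (hp : p ∈ U)
    (hθ : DiffFormAt θ (Γ p)) (a b : ℝ × ℝ) :
    ∃ fa fb : ℝ × ℝ →L[ℝ] ℝ,
      HasFDerivAt (fun q => θ (Γ q) (mfderiv 𝓘(ℝ, ℝ × ℝ) (𝓡 3) Γ q a)) fa p ∧
      HasFDerivAt (fun q => θ (Γ q) (mfderiv 𝓘(ℝ, ℝ × ℝ) (𝓡 3) Γ q b)) fb p ∧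
      fa b - fb a = extDeriv₁ θ (Γ p) (mfderiv 𝓘(ℝ, ℝ × ℝ) (𝓡 3) Γ p b)
        (mfderiv 𝓘(ℝ, ℝ × ℝ) (𝓡 3) Γ p a) := by
  set x := Γ p with hx
  have hb : x ∈ (triv x).baseSet := FiberBundle.mem_baseSet_trivializationAt' _
  set F := extChartAt (𝓡 3) x ∘ Γ with hF
  have hΓp := (hΓ p hp).contMDiffAt (hU.mem_nhds hp)
  have hFp : ContDiffAt ℝ ∞ F p :=
    ((contMDiffAt_extChartAt (I := 𝓡 3) (n := ∞) (x := x)).comp p hΓp).contDiffAt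
  have hF2 : HasFDerivAt (fderiv ℝ F) (fderiv ℝ (fderiv ℝ F) p) p :=
    ((hFp.fderiv_right (m := 1) (by exact WithTop.coe_le_coe.2 le_top)).differentiableAt
      one_ne_zero).hasFDerivAt
  have hsymm : ∀ a b, fderiv ℝ (fderiv ℝ F) p a b = fderiv ℝ (fderiv ℝ F) p b a :=
    fun a b => (hFp.isSymmSndFDerivAt (by simpa using ENat.LEInfty.out)).eq a b
  have hH : HasFDerivAt (fun q => formInChart θ x (Γ q))
      ((mvfderiv (𝓡 3) (formInChart θ x) x).comp (mfderiv 𝓘(ℝ, ℝ × ℝ) (𝓡 3) Γ p) :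
        ℝ × ℝ →L[ℝ] (E3 →L[ℝ] ℝ)) p := by
    have := (mdifferentiableAt_formInChart hθ).hasMFDerivAt.comp p
      (hΓp.mdifferentiableAt (by simp)).hasMFDerivAt
    exact hasMFDerivAt_iff_hasFDerivAt.1 this
  have key : ∀ a : ℝ × ℝ, HasFDerivAt
      (fun q => θ (Γ q) (mfderiv 𝓘(ℝ, ℝ × ℝ) (𝓡 3) Γ q a)) _ p := fun a => by
    have h1 := hH.clm_apply (hF2.clm_apply (hasFDerivAt_const a p))
    refine h1.congr_of_eventuallyEq ?_
    filter_upwards [hU.mem_nhds hp, hΓp.continuousAt.eventually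
      ((triv x).open_baseSet.mem_nhds hb)] with q hqU hq
    rw [hF, fderiv_coords_eq hU hΓ hqU hq, formInChart, ContinuousLinearMap.comp_apply,
      Trivialization.symmL_apply (triv x) hq, Trivialization.symm_apply_apply_mk _ hq]
  -- By the product rule each derivative is a second derivative of `F` plus a derivative of the
  -- coefficients of `θ`. The former cancel by symmetry; the latter form `dθ`, the bracket of the
  -- coordinate extensions being zero.
  refine ⟨_, _, key a, key b, ?_⟩
  rw [extDeriv₁_eq, mvfderiv_form_extend hθ, mvfderiv_form_extend hθ,
    ← fderiv_coords_eq hU hΓ hp hb, ← fderiv_coords_eq hU hΓ hp hb]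
  simp only [hsymm a b, ContinuousLinearMap.comp_zero, zero_add, add_apply,
    ContinuousLinearMap.comp_apply, ContinuousLinearMap.flip_apply, add_sub_add_left_eq_sub]
  rfl

end MixedPartials

/-! ### Pointwise contact geometry -/

section ContactAlgebra

variable {M : Type*} [TopologicalSpace M] [ChartedSpace E3 M] [IsManifold (𝓡 3) ∞ M]

theorem exists_bilinear_extDeriv₁ {θ : ∀ x : M, Tan x →L[ℝ] ℝ} {x : M} (hθ : DiffFormAt θ x) :
    ∃ B : Tan x →ₗ[ℝ] Tan x →ₗ[ℝ] ℝ, (∀ v w, extDeriv₁ θ x v w = B v w) ∧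
      ∀ v w, B v w = -B w v := by
  let B : Tan x →L[ℝ] Tan x →L[ℝ] ℝ :=
    TensorialAt.mkHom₂ (fun U V : ∀ x : M, Tan x => dFields θ U V x) x
      (fun V _ => tensorial_dFields_left hθ V) (fun U _ => tensorial_dFields_right hθ U)
  have hB : ∀ v w, extDeriv₁ θ x v w = B v w := fun v w =>
    (TensorialAt.mkHom₂_apply_eq_extend (Φ := fun U V : ∀ x : M, Tan x => dFields θ U V x)
      (fun V _ => tensorial_dFields_left hθ V) (fun U _ => tensorial_dFields_right hθ U) v w).symm
  refine ⟨(ContinuousLinearMap.coeLM ℝ).comp B.toLinearMap, hB, fun v w => ?_⟩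
  change B v w = - B w v
  rw [← hB, ← hB, extDeriv₁_eq, extDeriv₁_eq]
  ring

namespace ContactSubRiemannian

variable (C : ContactSubRiemannian M)

theorem diffFormAt_θ (x : M) : DiffFormAt C.θ x := C.contMDiff_θ.mdifferentiableAt (by simp)

theorem inner_T (x : M) (v : Tan x) : C.g.inner x v (C.T x) = C.θ x v := by
  have h : C.g.inner x (v - C.θ x v • C.T x) (C.T x) = 0 :=
    C.g_horizontal_T x _ (by simp [C.θ_T])
  simp only [map_sub, map_smul, sub_apply, smul_apply, C.g_T_T, smul_eq_mul] at h
  linarith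

/-- Only the horizontal part `h = v - θ(v) T` matters, because `J T = 0` and `dθ(·, T) = 0`. Then
`dθ(J h, h) = -dθ(h, J h) = -2 |h|²`, and `|h|² = |v|² - θ(v)²` by orthogonality. -/
theorem extDeriv₁_J_self (x : M) (v : Tan x) :
    extDeriv₁ C.θ x (C.J x v) v = -2 * (C.g.inner x v v - C.θ x v ^ 2) := by
  obtain ⟨B, hB, hanti⟩ := exists_bilinear_extDeriv₁ (C.diffFormAt_θ x)
  set h := v - C.θ x v • C.T x with hh
  have hθh : C.θ x h = 0 := by simp [hh, C.θ_T]
  have hv : v = h + C.θ x v • C.T x := by simp [hh]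
  have hJ : C.J x v = C.J x h := by simp [hh, C.J_T]
  have hg := C.g_horizontal x h h hθh hθh
  have hT : B (C.J x h) (C.T x) = 0 := by rw [hanti, ← hB, C.dθ_T, neg_zero]
  have hgv : C.g.inner x h h = C.g.inner x v v - C.θ x v ^ 2 := by
    have h1 := C.inner_T x v
    have h2 : C.g.inner x (C.T x) v = C.θ x v := by rw [C.g.symm, h1]
    simp only [hh, map_sub, map_smul, sub_apply, smul_apply, smul_eq_mul, h1, h2, C.g_T_T]
    ring
  rw [hB] at hg ⊢
  rw [hJ]
  have hsplit : B (C.J x h) v = B (C.J x h) h := by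
    conv_lhs => rw [hv]
    rw [map_add, map_smul, hT, smul_zero, add_zero]
  rw [hsplit, hanti, ← hgv]
  linarith

end ContactSubRiemannian

end ContactAlgebra

/-! ### Uniqueness for a linear equation -/

section LinearODE

/-- A solution of a homogeneous linear equation with zero initial value vanishes. -/
theorem eq_zero_of_hasDerivAt_mul {f c : ℝ → ℝ} {t : ℝ} (ht : 0 < t)
    (hf : ContinuousOn f (Icc 0 t)) (hc : ContinuousOn c (Icc 0 t))
    (hd : ∀ r ∈ Ioo 0 t, HasDerivAt f (c r * f r) r) (h0 : f 0 = 0) : f t = 0 := by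
  obtain ⟨K, hK⟩ := isCompact_Icc.exists_bound_of_continuousOn hc
  -- The equation is known only on the open interval, so Grönwall starts at `ε > 0`; then `ε → 0`,
  -- using continuity of `f` at `0`.
  have hbound : ∀ ε ∈ Ioo 0 t, ‖f t‖ ≤ ‖f ε‖ * Real.exp (K * (t - ε)) := by
    intro ε hε
    have := norm_le_gronwallBound_of_norm_deriv_right_le (f := f) (f' := fun r => c r * f r)
      (δ := ‖f ε‖) (K := K) (ε := 0) (a := ε) (b := t)
      (hf.mono (Icc_subset_Icc_left hε.1.le))
      (fun r hr => (hd r ⟨hε.1.trans_le hr.1, hr.2⟩).hasDerivWithinAt) le_rfl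
      (fun r hr => by
        rw [norm_mul, add_zero]
        exact mul_le_mul_of_nonneg_right (hK r ⟨hε.1.le.trans hr.1, hr.2.le⟩) (norm_nonneg _))
      t ⟨hε.2.le, le_rfl⟩
    rwa [gronwallBound_ε0] at this
  have hlim : Tendsto (fun ε => ‖f ε‖ * Real.exp (K * (t - ε))) (𝓝[Ioo 0 t] 0) (𝓝 0) := by
    have h1 : Tendsto f (𝓝[Ioo 0 t] 0) (𝓝 0) := by
      have := (hf 0 ⟨le_rfl, ht.le⟩).mono Ioo_subset_Icc_self
      rwa [ContinuousWithinAt, h0] at this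
    have h2 : Tendsto (fun ε => Real.exp (K * (t - ε))) (𝓝[Ioo 0 t] 0)
        (𝓝 (Real.exp (K * (t - 0)))) :=
      (Continuous.tendsto (by fun_prop) 0).mono_left nhdsWithin_le_nhds
    simpa using h1.norm.mul h2
  have : NeBot (𝓝[Ioo 0 t] (0 : ℝ)) := by
    rw [nhdsWithin_Ioo_eq_nhdsGT ht]; infer_instance
  have hle := ge_of_tendsto hlim (eventually_mem_nhdsWithin.mono hbound)
  exact norm_le_zero_iff.1 hle

end LinearODE

/-! ### Velocities and the arc-length integral along the flow -/

section Flow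

variable {M : Type*} [TopologicalSpace M] [ChartedSpace E3 M] [IsManifold (𝓡 3) ∞ M]

theorem velocity_snd_eq {S I : Set ℝ} {γ : ℝ → ℝ → M} (hI : UniqueDiffOn ℝ I) {p : ℝ × ℝ}
    (hp : p ∈ S ×ˢ I)
    (hγ : ContMDiffOn 𝓘(ℝ, ℝ × ℝ) (𝓡 3) ∞ (fun p : ℝ × ℝ => γ p.1 p.2) (S ×ˢ I)) :
    velocity I (fun r => γ p.1 r) p.2 =
      mfderivWithin 𝓘(ℝ, ℝ × ℝ) (𝓡 3) (fun p : ℝ × ℝ => γ p.1 p.2) (S ×ˢ I) p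
        ((0, 1) : ℝ × ℝ) := by
  have h1 := ((hγ p hp).mdifferentiableWithinAt (by simp)).hasMFDerivWithinAt
  have h2 : HasMFDerivWithinAt 𝓘(ℝ, ℝ) 𝓘(ℝ, ℝ × ℝ) (fun r : ℝ => (p.1, r)) I p.2
      (ContinuousLinearMap.inr ℝ ℝ ℝ) :=
    ((hasFDerivAt_prodMk_right p.1 p.2).hasFDerivWithinAt).hasMFDerivWithinAt
  have hmaps : I ⊆ (fun r : ℝ => (p.1, r)) ⁻¹' (S ×ˢ I) := fun r hr => ⟨hp.1, hr⟩
  have h3 := (HasMFDerivWithinAt.comp p.2 (f := fun r : ℝ => (p.1, r)) h1 h2 hmaps).mfderivWithin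
    (hI p.2 hp.2).uniqueMDiffWithinAt
  rw [velocity]
  erw [h3]
  rfl

variable {C : ContactSubRiemannian M} {D : Connection M}

theorem inner_unitTangent_self {S : Set ℝ} {c : ℝ → M} {u : ℝ} (h : velocity S c u ≠ 0) :
    C.g.inner (c u) (unitTangent C S c u) (unitTangent C S c u) = 1 := by
  have hs : speed C S c u ≠ 0 := (speed_pos h).ne'
  have h1 : C.g.inner (c u) (velocity S c u) (velocity S c u) = speed C S c u ^ 2 :=
    (Real.sq_sqrt (C.g.pos _ _ h).le).symm
  simp only [unitTangent, map_smul, smul_apply, smul_eq_mul, h1]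
  field_simp

theorem form_velocity_eq {S : Set ℝ} {c : ℝ → M} {u : ℝ} (h : velocity S c u ≠ 0) :
    C.θ (c u) (velocity S c u) = speed C S c u * contactNormality C S c u := by
  have hs : speed C S c u ≠ 0 := (speed_pos h).ne'
  rw [contactNormality, C.inner_T, unitTangent, map_smul, smul_eq_mul]
  field_simp

theorem contactNormality_congr {S : Set ℝ} {c₁ c₂ : ℝ → M} (h : EqOn c₁ c₂ S) {u : ℝ}
    (hu : u ∈ S) :
    contactNormality C S c₁ u = contactNormality C S c₂ u := by
  have hv : (velocity S c₁ u : E3) = velocity S c₂ u := by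
    have := mfderivWithin_congr (I := 𝓘(ℝ, ℝ)) (I' := 𝓡 3) h (h hu)
    exact congrArg (fun L : ℝ →L[ℝ] E3 => L 1) this
  -- The two velocities live in tangent spaces at points that are only propositionally equal;
  -- vectors are therefore taken in the model space `E3` and the base point is substituted.
  have key : ∀ x y : M, x = y → ∀ v : E3,
      C.g.inner x ((√(C.g.inner x (v : Tan x) (v : Tan x)))⁻¹ • (v : Tan x)) (C.T x) =
        C.g.inner y ((√(C.g.inner y (v : Tan y) (v : Tan y)))⁻¹ • (v : Tan y)) (C.T y) := by
    rintro x _ rfl v; rfl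
  refine (key _ _ (h hu) (velocity S c₁ u)).trans ?_
  rw [contactNormality, unitTangent, speed, ← hv]
  rfl

theorem hasDerivAt_integralInvCurvature {S : Set ℝ} (hS : S.OrdConnected) {c : ℝ → M} {a u : ℝ}
    (ha : a ∈ S) (hu : u ∈ interior S)
    (hk : ContinuousOn (fun v => (curvature C D S c v)⁻¹ * speed C S c v) S) :
    HasDerivAt (fun v => integralInvCurvature C D S c a v)
      ((curvature C D S c u)⁻¹ * speed C S c u) u := by
  refine intervalIntegral.integral_hasDerivAt_right ?_ ?_ ?_
  · exact (hk.mono (hS.uIcc_subset ha (interior_subset hu))).intervalIntegrable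
  · exact ContinuousOn.stronglyMeasurableAtFilter isOpen_interior (hk.mono interior_subset) u hu
  · exact hk.continuousAt (mem_interior_iff_mem_nhds.1 hu)

end Flow

/-! ### Intervals with nonempty interior -/

section TimeInterval

theorem ordConnected_timeInterval (T₀ : EReal) : (timeInterval T₀).OrdConnected :=
  ⟨fun _ hx _ hy _ hz => ⟨hx.1.trans hz.1, (EReal.coe_le_coe_iff.2 hz.2).trans_lt hy.2⟩⟩

theorem nontrivial_timeInterval {T₀ : EReal} {t : ℝ} (ht : t ∈ timeInterval T₀) :
    (timeInterval T₀).Nontrivial := by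
  obtain ⟨r, hr₁, hr₂⟩ := EReal.lt_iff_exists_real_btwn.1 ht.2
  have h : t < r := EReal.coe_lt_coe_iff.1 hr₁
  exact ⟨t, ht, r, ⟨ht.1.trans h.le, hr₂⟩, h.ne⟩

theorem nonempty_interior_of_ordConnected {S : Set ℝ} (hS : S.OrdConnected) (hn : S.Nontrivial) :
    (interior S).Nonempty := by
  obtain ⟨x, hx, y, hy, hxy⟩ := hn.exists_lt
  exact (nonempty_Ioo.2 hxy).mono (isOpen_Ioo.subset_interior_iff.2
    (Ioo_subset_Icc_self.trans (hS.out hx hy)))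

end TimeInterval

variable {M : Type*} [TopologicalSpace M] [ChartedSpace E3 M] [IsManifold (𝓡 3) ∞ M]
  {C : ContactSubRiemannian M} {D : Connection M}
  {S : Set ℝ} {a : ℝ} {T₀ : EReal} {γ₀ : ℝ → M} {γ : ℝ → ℝ → M}

/-! ### Preservation of the Legendrian condition -/

namespace IsExpandingFlow

/-- Along the flow `θ(∂γ/∂u)` satisfies a homogeneous linear equation in `t`. -/
theorem hasDerivAt_form_velocity [T2Space M]
    (hD : CovariantDerivative.ContMDiffCovariantDerivative D ∞)
    (hSc : S.OrdConnected) (hS : UniqueDiffOn ℝ S) (hI : UniqueDiffOn ℝ (timeInterval T₀))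
    (ha : a ∈ S) (hγ : IsExpandingFlow C D S a T₀ γ₀ γ) {u t : ℝ}
    (hu : u ∈ interior S) (ht : t ∈ interior (timeInterval T₀)) :
    HasDerivAt (fun r => C.θ (γ u r) (velocity S (fun v => γ v r) u))
      ((-2 * (curvature C D S (fun v => γ v t) u)⁻¹ * contactNormality C S (fun v => γ v t) u) *
        C.θ (γ u t) (velocity S (fun v => γ v t) u)) t := by
  set I := timeInterval T₀ with hIdef
  set Γ : ℝ × ℝ → M := fun p => γ p.1 p.2 with hΓ
  have himm : ∀ p ∈ S ×ˢ I, velocity S (fun v => γ v p.2) p.1 ≠ 0 :=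
    fun p hp => hγ.immersed p.2 hp.2 p.1 hp.1
  have htI := interior_subset ht
  have huS := interior_subset hu
  have hU : IsOpen (interior S ×ˢ interior I) := isOpen_interior.prod isOpen_interior
  have hsub : interior S ×ˢ interior I ⊆ S ×ˢ I := prod_mono interior_subset interior_subset
  have hvel₁ : ∀ q ∈ interior S ×ˢ interior I, velocity S (fun v => γ v q.2) q.1 =
      mfderiv 𝓘(ℝ, ℝ × ℝ) (𝓡 3) Γ q ((1, 0) : ℝ × ℝ) := fun q hq => by
    rw [velocity_fst_eq hS (hsub hq) hγ.smooth,
      mfderivWithin_of_mem_nhds (mem_of_superset (hU.mem_nhds hq) hsub)]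
  have hvel₂ : ∀ q ∈ interior S ×ˢ interior I, velocity I (fun r => γ q.1 r) q.2 =
      mfderiv 𝓘(ℝ, ℝ × ℝ) (𝓡 3) Γ q ((0, 1) : ℝ × ℝ) := fun q hq => by
    rw [velocity_snd_eq hI (hsub hq) hγ.smooth,
      mfderivWithin_of_mem_nhds (mem_of_superset (hU.mem_nhds hq) hsub)]
  have hp : (u, t) ∈ interior S ×ˢ interior I := ⟨hu, ht⟩
  obtain ⟨f₁, f₂, hf₁, hf₂, hd⟩ := hasFDerivAt_form_mfderiv hU (hγ.smooth.mono hsub) hp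
    (C.diffFormAt_θ _) (1, 0) (0, 1)
  have hlineu : HasDerivAt (fun v : ℝ => (v, t)) ((1, 0) : ℝ × ℝ) u :=
    (hasDerivAt_id _).prodMk (hasDerivAt_const _ _)
  have hlinet : HasDerivAt (fun r : ℝ => (u, r)) ((0, 1) : ℝ × ℝ) t :=
    (hasDerivAt_const _ _).prodMk (hasDerivAt_id _)
  set k := curvature C D S (fun v => γ v t) u with hk
  set s := speed C S (fun v => γ v t) u with hs
  set τ := contactNormality C S (fun v => γ v t) u with hτ
  have hsne : s ≠ 0 := (speed_pos (himm _ (hsub hp))).ne'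
  -- The term along `J X` is horizontal, so `θ` sees only the Reeb component.
  have hθt : ∀ v ∈ S, C.θ (γ v t) (velocity I (fun r => γ v r) t) =
      -2 * integralInvCurvature C D S (fun v => γ v t) a v := fun v hv => by
    rw [hγ.evolution t htI v hv]
    simp [C.θ_J, C.θ_T]
  have hkc : ContinuousOn (fun v => (curvature C D S (fun v => γ v t) v)⁻¹ *
      speed C S (fun v => γ v t) v) S := by
    have hmaps : MapsTo (fun v : ℝ => (v, t)) S (S ×ˢ I) := fun v hv => ⟨hv, htI⟩
    have h1 := (contDiffOn_curvature hD hS hI hγ.smooth himm (C := C)).continuousOn.comp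
      (by fun_prop : Continuous fun v : ℝ => (v, t)).continuousOn hmaps
    have h2 := (contDiffOn_speed hS hI hγ.smooth himm (C := C)).continuousOn.comp
      (by fun_prop : Continuous fun v : ℝ => (v, t)).continuousOn hmaps
    exact (h1.inv₀ fun v hv => hγ.curvature_ne_zero t htI v hv).mul h2
  have hf₂u : f₂ (1, 0) = -2 * (k⁻¹ * s) := by
    have h1 := hf₂.comp_hasDerivAt u hlineu
    have h2 := (hasDerivAt_integralInvCurvature hSc ha hu hkc).const_mul (-2)
    refine h1.unique (h2.congr_of_eventuallyEq ?_)
    filter_upwards [isOpen_interior.mem_nhds hu] with v hv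
    rw [← hθt v (interior_subset hv), hvel₂ (v, t) ⟨hv, ht⟩]
    rfl
  -- Here the Reeb component drops out instead, and `|X| = 1` turns `extDeriv₁_J_self` into `-2 (1 -
  -- τ²)`.
  have hdθ : extDeriv₁ C.θ (γ u t) (velocity I (fun r => γ u r) t)
      (velocity S (fun v => γ v t) u) = 2 * s * k⁻¹ * (1 - τ ^ 2) := by
    obtain ⟨B, hB, -⟩ := exists_bilinear_extDeriv₁ (C.diffFormAt_θ (γ u t))
    set X := unitTangent C S (fun v => γ v t) u with hX
    have hv : velocity S (fun v => γ v t) u = s • X := by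
      rw [hX, unitTangent, smul_smul, ← hs, mul_inv_cancel₀ hsne, one_smul]
    have h1 := C.extDeriv₁_J_self (γ u t) X
    rw [inner_unitTangent_self (himm _ (hsub hp)), ← C.inner_T] at h1
    have h2 := C.dθ_T (γ u t) X
    rw [hB] at h1 h2 ⊢
    rw [hγ.evolution t htI u huS, hv]
    simp only [map_sub, map_smul, LinearMap.sub_apply, LinearMap.smul_apply, smul_eq_mul, ← hX,
      ← hk, h1, h2]
    change _ = 2 * s * k⁻¹ * (1 - (C.g.inner (γ u t) X (C.T (γ u t))) ^ 2)
    ring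
  -- The terms `∓2 s k⁻¹` cancel. One factor of the remaining `-2 k⁻¹ s τ²` is absorbed into `θ(γ_u)
  -- = s τ`, making the equation linear with coefficient `-2 k⁻¹ τ`.
  have hf₁t : f₁ (0, 1) = (-2 * k⁻¹ * τ) * C.θ (γ u t) (velocity S (fun v => γ v t) u) := by
    rw [← hvel₁ _ hp, ← hvel₂ _ hp] at hd
    rw [form_velocity_eq (himm _ (hsub hp))]
    have : f₁ (0, 1) - f₂ (1, 0) = 2 * s * k⁻¹ * (1 - τ ^ 2) := hd.trans hdθ
    rw [hf₂u] at this
    linear_combination this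
  rw [← hf₁t]
  refine (hf₁.comp_hasDerivAt t hlinet).congr_of_eventuallyEq ?_
  filter_upwards [isOpen_interior.mem_nhds ht] with r hr
  rw [hvel₁ (u, r) ⟨hu, hr⟩]
  rfl

theorem isLegendrian [T2Space M]
    (hD : CovariantDerivative.ContMDiffCovariantDerivative D ∞)
    (hSc : S.OrdConnected) (hSn : S.Nontrivial) (ha : a ∈ S)
    (hγ : IsExpandingFlow C D S a T₀ γ₀ γ) (hγ₀ : IsLegendrian C S γ₀) {t : ℝ}
    (ht : t ∈ timeInterval T₀) : IsLegendrian C S (fun v => γ v t) := by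
  have hIc := ordConnected_timeInterval T₀
  have h0 : (0 : ℝ) ∈ timeInterval T₀ := ⟨le_rfl, (EReal.coe_le_coe_iff.2 ht.1).trans_lt ht.2⟩
  have hS := uniqueDiffOn_convex hSc.convex (nonempty_interior_of_ordConnected hSc hSn)
  have hI := uniqueDiffOn_convex hIc.convex
    (nonempty_interior_of_ordConnected hIc (nontrivial_timeInterval ht))
  set I := timeInterval T₀ with hIdef
  have himm : ∀ p ∈ S ×ˢ I, velocity S (fun v => γ v p.2) p.1 ≠ 0 :=
    fun p hp => hγ.immersed p.2 hp.2 p.1 hp.1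
  have hTs : SmoothAlong (S ×ˢ I) γ (fun p => C.T (γ p.1 p.2)) :=
    C.contMDiff_T.comp_contMDiffOn hγ.smooth
  have hτc : ContinuousOn (fun p : ℝ × ℝ => contactNormality C S (fun v => γ v p.2) p.1)
      (S ×ˢ I) :=
    ((smoothAlong_unitTangent hS hI hγ.smooth himm).inner hγ.smooth hTs).continuousOn
  have hfc : ContinuousOn (fun p : ℝ × ℝ => C.θ (γ p.1 p.2) (velocity S (fun v => γ v p.2) p.1))
      (S ×ˢ I) := by
    simp only [← C.inner_T]
    exact ((smoothAlong_velocity hS hI hγ.smooth).inner hγ.smooth hTs).continuousOn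
  have hkc : ContinuousOn (fun p : ℝ × ℝ => curvature C D S (fun v => γ v p.2) p.1) (S ×ˢ I) :=
    (contDiffOn_curvature hD hS hI hγ.smooth himm).continuousOn
  have hinit : ∀ u ∈ S, contactNormality C S (fun v => γ v 0) u = 0 := fun u hu => by
    rw [contactNormality_congr hγ.initial hu, hγ₀ u hu]
  have hint : ∀ u ∈ interior S, contactNormality C S (fun v => γ v t) u = 0 := by
    intro u hu
    have huS := interior_subset hu
    rcases ht.1.eq_or_lt with rfl | htpos
    · exact hinit u huS
    have hIcc : Icc 0 t ⊆ I := hIc.out h0 ht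
    have hline : ContinuousOn (fun r : ℝ => (u, r)) (Icc 0 t) := by fun_prop
    have hmaps : MapsTo (fun r : ℝ => (u, r)) (Icc 0 t) (S ×ˢ I) := fun r hr => ⟨huS, hIcc hr⟩
    have hf0 := eq_zero_of_hasDerivAt_mul htpos (hfc.comp hline hmaps)
      ((continuousOn_const.mul ((hkc.comp hline hmaps).inv₀ fun r hr =>
        hγ.curvature_ne_zero r (hIcc hr) u huS)).mul (hτc.comp hline hmaps))
      (fun r hr => hγ.hasDerivAt_form_velocity hD hSc hS hI ha hu
        (isOpen_Ioo.subset_interior_iff.2 (Ioo_subset_Icc_self.trans hIcc) hr))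
      (by
        change C.θ (γ u 0) (velocity S (fun v => γ v 0) u) = 0
        rw [form_velocity_eq (c := fun v => γ v 0) (himm (u, 0) ⟨huS, h0⟩), hinit u huS, mul_zero])
    have h1 : C.θ (γ u t) (velocity S (fun v => γ v t) u) = 0 := hf0
    rw [form_velocity_eq (c := fun v => γ v t) (himm (u, t) ⟨huS, ht⟩)] at h1
    exact (mul_eq_zero.1 h1).resolve_left (speed_pos (himm (u, t) ⟨huS, ht⟩)).ne'
  have hcont : ContinuousOn (fun u => contactNormality C S (fun v => γ v t) u) S :=
    hτc.comp (Continuous.continuousOn (f := fun u : ℝ => (u, t)) (by fun_prop))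
      fun u hu => ⟨hu, ht⟩
  have hconv : Convex ℝ S := hSc.convex
  -- A nondegenerate interval lies in the closure of its interior, so continuity of `τ` carries its
  -- vanishing to end points.
  have hcl : S ⊆ closure (interior S) := by
    rw [hconv.closure_interior_eq_closure_of_nonempty_interior
      (nonempty_interior_of_ordConnected hSc hSn)]
    exact subset_closure
  exact EqOn.of_subset_closure (g := fun _ => (0 : ℝ)) hint hcont continuousOn_const
    interior_subset hcl

end IsExpandingFlow

end LegendrianFlow

end

theorem proposition3p2 {M : Type*} [TopologicalSpace M] [T2Space M]
    [ChartedSpace LegendrianFlow.E3 M] [IsManifold (𝓡 3) ∞ M]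
    (C : LegendrianFlow.ContactSubRiemannian M) (D : LegendrianFlow.Connection M)
    (hD : LegendrianFlow.IsTanakaConnection C D) (hS : LegendrianFlow.IsSasakian C D)
    (S : Set ℝ) (hS_interval : S.OrdConnected) (hS_nontrivial : S.Nontrivial)
    (a : ℝ) (ha : a ∈ S) (T₀ : EReal) (γ₀ : ℝ → M) (γ : ℝ → ℝ → M)
    (hγ : LegendrianFlow.IsExpandingFlow C D S a T₀ γ₀ γ)
    (hγ₀ : LegendrianFlow.IsLegendrian C S γ₀) :
    (∀ t ∈ LegendrianFlow.timeInterval T₀,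
      LegendrianFlow.IsLegendrian C S (fun v => γ v t)) ∧
    (∀ u ∈ S, ∀ t ∈ LegendrianFlow.timeInterval T₀,
      HasDerivWithinAt
        (fun r => LegendrianFlow.contactNormality C S (fun v => γ v r) u)
        (-LegendrianFlow.contactNormality C S (fun v => γ v t) u)
        (LegendrianFlow.timeInterval T₀) t) := by

  have hL : ∀ t ∈ LegendrianFlow.timeInterval T₀,
      LegendrianFlow.IsLegendrian C S (fun v => γ v t) := fun t ht =>
    hγ.isLegendrian hD.smooth hS_interval hS_nontrivial ha hγ₀ ht
  refine ⟨hL, fun u hu t ht => ?_⟩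
  rw [hL t ht u hu, neg_zero]
  exact (hasDerivWithinAt_const t _ (0 : ℝ)).congr (fun r hr => hL r hr u hu) (hL t ht u hu)
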